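/- Let $H$ be a complex Hilbert space and $\mathcal{B}(H)$ the algebra of bounded operators on $H$. A von Neumann algebra on $H$ is a $^*$-subalgebra of $\mathcal{B}(H)$ that equals its double commutant. Let $\mathcal{A}$ be a von Neumann algebra on $H$ and let $\mathbb{P}:\mathcal{A}\to\mathbb{C}$ be a normal state, i.e. a linear map with $\mathbb{P}(A^*A)\ge 0$ for all $A\in\mathcal{A}$ and $\mathbb{P}(I)=1$ that is weak operator continuous on the unit ball of $\mathcal{A}$. Write $\|X\|_{\mathbb{P}}:=\mathbb{P}(X^*X)^{1/2}$ for $X\in\mathcal{A}$. Let $\mathcal{C}$ be a von Neumann algebra on $H$ contained in the center $\{Z\in\mathcal{A} : AZ=ZA \text{ for all } A\in\mathcal{A}\}$ of $\mathcal{A}$. For $A\in\mathcal{A}$, an element $P\in\mathcal{C}$ is called a version of $\mathbb{P}(A|\mathcal{C})$ if $\mathbb{P}(PC)=\mathbb{P}(AC)$ for all $C\in\mathcal{C}$; a map $\mathbb{P}(\,\cdot\,|\mathcal{C}):\mathcal{A}\to\mathcal{C}$ is called (a version of) the conditional expectation from $\mathcal{A}$ onto $\mathcal{C}$ if $\mathbb{P}(A|\mathcal{C})$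 is such an element for every $A\in\mathcal{A}$. Then: 1. (Existence) A conditional expectation $\mathbb{P}(\,\cdot\,|\mathcal{C}):\mathcal{A}\to\mathcal{C}$ exists. 2. (Uniqueness with probability one) For every $A\in\mathcal{A}$, any two versions $P,Q\in\mathcal{C}$ of $\mathbb{P}(A|\mathcal{C})$ satisfy $\|P-Q\|_{\mathbb{P}}=0$. 3. (Least mean square estimate) For every $A\in\mathcal{A}$ and every version of $\mathbb{P}(A|\mathcal{C})$, one has $\|A-\mathbb{P}(A|\mathcal{C})\|_{\mathbb{P}}\le\|A-C\|_{\mathbb{P}}$ for all $C\in\mathcal{C}$. -/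

import Mathlib

namespace QuantumProb

open scoped ComplexOrder

variable {H : Type*} [NormedAddCommGroup H] [InnerProductSpace ℂ H] [CompleteSpace H]

/-- The center `{Z ∈ 𝒜 ; A Z = Z A for all A ∈ 𝒜}` of a von Neumann algebra `𝒜`. -/
def center (𝒜 : VonNeumannAlgebra H) : Set (H →L[ℂ] H) :=
  {Z | Z ∈ 𝒜 ∧ ∀ A ∈ 𝒜, A * Z = Z * A}

/-- A linear functional on `𝒜` is normal if it is continuous on the unit ball of `𝒜` for the
topology induced on that ball by the weak operator topology. -/
def IsNormal (𝒜 : VonNeumannAlgebra H) (P : 𝒜.toStarSubalgebra →ₗ[ℂ] ℂ) : Prop :=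
  @Continuous {A : 𝒜.toStarSubalgebra // ‖(A : H →L[ℂ] H)‖ ≤ 1} ℂ
    (TopologicalSpace.induced
      (fun A ↦ (ContinuousLinearMapWOT.ofCLM (A.1 : H →L[ℂ] H) : H →WOT[ℂ] H)) inferInstance)
    inferInstance (fun A ↦ P A.1)

/-- `(𝒜, P)` is a quantum probability space, i.e. `P` is a normal state on the von Neumann
algebra `𝒜`: a positive, normalised, normal linear functional. In the field `nonneg`, `0 ≤ z` for
a complex number `z` means that `z` is real and nonnegative. -/
structure IsNormalState (𝒜 : VonNeumannAlgebra H) (P : 𝒜.toStarSubalgebra →ₗ[ℂ] ℂ) : Prop where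
  nonneg : ∀ A : 𝒜.toStarSubalgebra, 0 ≤ P (star A * A)
  map_one : P 1 = 1
  normal : IsNormal 𝒜 P

/-- The inclusion of a von Neumann subalgebra `𝒞` of the center of `𝒜` into `𝒜`. -/
def incl {𝒜 𝒞 : VonNeumannAlgebra H} (h𝒞 : (𝒞 : Set (H →L[ℂ] H)) ⊆ center 𝒜)
    (C : 𝒞.toStarSubalgebra) : 𝒜.toStarSubalgebra :=
  ⟨C.1, (h𝒞 C.2).1⟩

/-- `X ∈ 𝒞` is a version of `P(A|𝒞)`: `P(X C) = P(A C)` for all `C ∈ 𝒞`. -/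
def IsVersion {𝒜 𝒞 : VonNeumannAlgebra H} (P : 𝒜.toStarSubalgebra →ₗ[ℂ] ℂ)
    (h𝒞 : (𝒞 : Set (H →L[ℂ] H)) ⊆ center 𝒜)
    (A : 𝒜.toStarSubalgebra) (X : 𝒞.toStarSubalgebra) : Prop :=
  ∀ C : 𝒞.toStarSubalgebra, P (incl h𝒞 X * incl h𝒞 C) = P (A * incl h𝒞 C)

/-- The map `E : 𝒜 → 𝒞` is (a version of) the conditional expectation `P(·|𝒞)`. -/
def IsCondExp {𝒜 𝒞 : VonNeumannAlgebra H} (P : 𝒜.toStarSubalgebra →ₗ[ℂ] ℂ)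
    (h𝒞 : (𝒞 : Set (H →L[ℂ] H)) ⊆ center 𝒜)
    (E : 𝒜.toStarSubalgebra → 𝒞.toStarSubalgebra) : Prop :=
  ∀ A : 𝒜.toStarSubalgebra, IsVersion P h𝒞 A (E A)

/-- The seminorm `‖X‖_P = P(X* X) ^ (1/2)`. For a state, `P(X* X)` is real and nonnegative, so it
equals its real part and the square root is the genuine one. -/
noncomputable def stateNorm {𝒜 : VonNeumannAlgebra H} (P : 𝒜.toStarSubalgebra →ₗ[ℂ] ℂ)
    (X : 𝒜.toStarSubalgebra) : ℝ :=
  Real.sqrt (P (star X * X)).re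

end QuantumProb

/-!
Uniqueness and the least squares property are Hilbert space geometry for the positive semidefinite
form `(X, Y) ↦ P (X* Y)`: that `X` is a version of `P(A|𝒞)` says that `A - X` is orthogonal to `𝒞`
(here it matters that `𝒞` is central), so the square of `‖A - C‖_P` splits by Pythagoras.

Existence is the substance. Scale so that `‖A‖ ≤ 1`. The functionals `C ↦ P (X C)` on `𝒞`, for `X`
in the unit ball of `𝒞`, form a convex set, and it is compact for pointwise convergence, because the
unit ball of `𝒞` is compact in the weak operator topology (`isCompact_wot_unitBall_inter`) and `P`
is normal (`continuous_map_mul_incl`). If `C ↦ P (A C)` were not one of them, Hahn–Banach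
(`exists_eq_of_forall_re_le`) would give a `C ∈ 𝒞` with `Re P (A C) > sup_X Re P (X C)`. This is
impossible (`exists_re_map_mul_le`): the supremum is at least `P |C|`, as one sees by letting `X`
approximate the adjoint of the phase of `C`, while Cauchy–Schwarz, applied to a factorisation of `C`
into two square roots of `|C|`, gives `Re P (A C) ≤ P |C|`. To stay within the continuous functional
calculus, `|C|` is replaced by `|C| + ε` in denominators, which costs an additive `ε`.
-/

namespace QuantumProb

open scoped ComplexOrder

/-! ### Separation from a compact convex set of functionals -/

section Separation

open Set

variable {V : Type*} [AddCommGroup V] [Module ℂ V]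

/-- A linear functional `ψ` which no vector separates from a family `φ` of functionals that is
convex and parametrised, pointwise continuously, by a compact space, belongs to the family. This is
Hahn–Banach in the algebraic dual with the topology of pointwise convergence, whose continuous
functionals are the evaluations at vectors. -/
theorem exists_eq_of_forall_re_le {K : Type*} [TopologicalSpace K] [CompactSpace K]
    (φ : K → Module.Dual ℂ V) (hφ : ∀ v, Continuous fun k ↦ φ k v)
    (hconv : Convex ℝ (range φ)) (ψ : Module.Dual ℂ V)
    (hψ : ∀ (v : V) (u : ℝ), (∀ k, (φ k v).re ≤ u) → (ψ v).re ≤ u) :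
    ∃ k, φ k = ψ := by
  let B : Module.Dual ℂ V →ₗ[ℂ] V →ₗ[ℂ] ℂ := LinearMap.id
  have : T2Space (WeakBilin B) := (WeakBilin.isEmbedding (B := B) Function.injective_id).t2Space
  let φ' : K → WeakBilin B := φ
  have hcont : Continuous φ' := WeakBilin.continuous_of_continuous_eval B hφ
  by_contra hne
  obtain ⟨f, u, hfu, hu⟩ := RCLike.geometric_hahn_banach_closed_point (𝕜 := ℂ)
    (E := WeakBilin B) (s := range φ') (x := ψ) hconv (isCompact_range hcont).isClosed hne
  obtain ⟨v, rfl⟩ := B.dualEmbedding_surjective f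
  exact (hψ v u fun k ↦ (hfu (φ' k) (mem_range_self k)).le).not_gt hu

end Separation

/-! ### Weak operator compactness of the unit ball -/

section Compactness

open Filter Topology Set

variable {H : Type*} [NormedAddCommGroup H] [InnerProductSpace ℂ H] [CompleteSpace H]

open scoped InnerProductSpace

/-- The unit ball of `B(H)` is compact in the weak operator topology: along an ultrafilter the
matrix coefficients of contractions converge, and their limits form a sesquilinear form bounded by
`1`, which comes from a contraction. -/
theorem isCompact_wot_unitBall :
    IsCompact {T : H →WOT[ℂ] H | ‖T.toCLM‖ ≤ 1} := by
  rw [isCompact_iff_ultrafilter_le_nhds]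
  intro U hU
  have hU' : ∀ᶠ T : H →WOT[ℂ] H in (U : Filter _), ‖T.toCLM‖ ≤ 1 := le_principal_iff.mp hU
  have hle : ∀ T : H →WOT[ℂ] H, ‖T.toCLM‖ ≤ 1 → ∀ x y : H, ‖⟪T x, y⟫_ℂ‖ ≤ 1 * ‖x‖ * ‖y‖ := by
    intro T hT x y
    refine (norm_inner_le_norm _ _).trans ?_
    gcongr
    exact T.toCLM.le_of_opNorm_le hT x
  have hlim : ∀ x y : H, ∃ b : ℂ, ‖b‖ ≤ 1 * ‖x‖ * ‖y‖ ∧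
      Tendsto (fun T : H →WOT[ℂ] H ↦ ⟪T x, y⟫_ℂ) U (𝓝 b) := by
    intro x y
    obtain ⟨b, hb, hb'⟩ := (isCompact_closedBall (0 : ℂ) (1 * ‖x‖ * ‖y‖)).ultrafilter_le_nhds
      (U.map fun T : H →WOT[ℂ] H ↦ ⟪T x, y⟫_ℂ) (by
        rw [Ultrafilter.coe_map, le_principal_iff]
        exact mem_map.2 <| hU'.mono fun T hT ↦ by simpa using hle T hT x y)
    exact ⟨b, by simpa using hb, hb'⟩
  choose b hb hlim using hlim
  -- Linearity in each variable passes to the limit.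
  let B₀ : H →ₗ⋆[ℂ] H →ₗ[ℂ] ℂ := LinearMap.mk₂'ₛₗ (starRingEnd ℂ) (RingHom.id ℂ) b
    (fun x x' y ↦ tendsto_nhds_unique (hlim _ _) <| by
      simpa [inner_add_left] using (hlim x y).add (hlim x' y))
    (fun c x y ↦ tendsto_nhds_unique (hlim _ _) <| by
      simpa [inner_smul_left, mul_comm] using (hlim x y).const_mul (starRingEnd ℂ c))
    (fun x y y' ↦ tendsto_nhds_unique (hlim _ _) <| by
      simpa [inner_add_right] using (hlim x y).add (hlim x y'))
    (fun c x y ↦ tendsto_nhds_unique (hlim _ _) <| by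
      simpa [inner_smul_right] using (hlim x y).const_mul c)
  let B : H →L⋆[ℂ] H →L[ℂ] ℂ := B₀.mkContinuous₂ 1 hb
  let S : H →L[ℂ] H := InnerProductSpace.continuousLinearMapOfBilin B
  have hS : ∀ x y, ⟪S x, y⟫_ℂ = b x y :=
    fun x y ↦ InnerProductSpace.continuousLinearMapOfBilin_apply B x y
  refine ⟨ContinuousLinearMapWOT.ofCLM S, ?_, ?_⟩
  · refine S.opNorm_le_of_re_inner_le zero_le_one fun x y hx hy ↦ ?_
    rw [hS]
    have h := (RCLike.re_le_norm (b x y)).trans (hb x y)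
    rwa [hx, hy, mul_one, mul_one] at h
  · have := (ContinuousLinearMapWOT.tendsto_iff_forall_inner_apply_tendsto (𝕜 := ℂ)
      (l := (U : Filter (H →WOT[ℂ] H))) (f := id) (A := ContinuousLinearMapWOT.ofCLM S)).2 ?_
    · exact this
    intro x y
    have h := (hlim x y).star
    rw [← hS] at h
    simpa using! h

/-- The unit ball of a von Neumann algebra is compact in the weak operator topology, since the
algebra is the commutant of its commutant and hence closed. -/
theorem isCompact_wot_unitBall_inter (S : VonNeumannAlgebra H) :
    IsCompact {T : H →WOT[ℂ] H | T.toCLM ∈ S ∧ ‖T.toCLM‖ ≤ 1} := by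
  have hcl : IsClosed {T : H →WOT[ℂ] H | T.toCLM ∈ S} := by
    have : {T : H →WOT[ℂ] H | T.toCLM ∈ S} = ⋂ g ∈ S.commutant,
        {T | ContinuousLinearMapWOT.ofCLM g * T = T * ContinuousLinearMapWOT.ofCLM g} := by
      ext T
      simp only [mem_ofPred_eq, mem_iInter]
      conv_lhs => rw [← S.commutant_commutant, VonNeumannAlgebra.mem_commutant_iff]
      refine forall₂_congr fun g _ ↦ ?_
      rw [← ContinuousLinearMapWOT.toCLM_injective.eq_iff]
      rfl
    rw [this]
    exact isClosed_biInter fun g _ ↦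
      isClosed_eq (continuous_const_mul _) (continuous_mul_const _)
  exact isCompact_wot_unitBall.inter_left hcl

end Compactness

/-! ### Positive functionals -/

section Positive

variable {A : Type*} [Ring A] [StarRing A] [Algebra ℂ A] [StarModule ℂ A] {P : A →ₗ[ℂ] ℂ}

/-- Positive functionals are hermitian: compare the imaginary parts of `P (x* x)` for `x = 1`, `a`,
`1 + a` and `1 + i a`. -/
theorem map_star_of_nonneg (hP : ∀ a, 0 ≤ P (star a * a)) (a : A) :
    P (star a) = star (P a) := by
  have h1 := (Complex.nonneg_iff.1 (hP 1)).2
  have h2 := (Complex.nonneg_iff.1 (hP a)).2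
  have h3 := (Complex.nonneg_iff.1 (hP (1 + a))).2
  have h4 := (Complex.nonneg_iff.1 (hP (1 + Complex.I • a))).2
  simp [add_mul, mul_add] at h1 h2 h3 h4
  apply Complex.ext <;> simp <;> linarith

/-- The additive form of the Cauchy–Schwarz inequality for `(x, y) ↦ P (x* y)`. -/
theorem two_mul_re_le (hP : ∀ a, 0 ≤ P (star a * a)) (x y : A) :
    2 * (P (star x * y)).re ≤ (P (star x * x)).re + (P (star y * y)).re := by
  have h := (Complex.nonneg_iff.1 (hP (x - y))).1
  have h' : (P (star y * x)).re = (P (star x * y)).re := by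
    rw [← star_star x, ← star_mul, map_star_of_nonneg hP, star_star]
    simp
  simp [sub_mul, mul_sub] at h
  linarith

end Positive

section CStar

variable {A : Type*} [CStarAlgebra A] {P : A →ₗ[ℂ] ℂ}

/-- Left multiplication by a contraction `a` does not increase the seminorm of a positive functional,
because `1 - a* a` is of the form `d* d`. -/
theorem re_map_star_mul_le (hP : ∀ a, 0 ≤ P (star a * a)) {a : A} (ha : ‖a‖ ≤ 1) (b : A) :
    (P (star (a * b) * (a * b))).re ≤ (P (star b * b)).re := by
  have hsa : IsSelfAdjoint (star a * a) := .star_mul_self a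
  have hn : ‖star a * a‖ ≤ 1 := by
    rw [CStarRing.norm_star_mul_self]; exact mul_le_one₀ ha (norm_nonneg _) ha
  let d : A := cfc (fun x : ℝ ↦ √(1 - x)) (star a * a)
  have hd : star d * d = 1 - star a * a := by
    have hds : star d = d := (cfc_predicate (fun x : ℝ ↦ √(1 - x)) (star a * a)).star_eq
    rw [hds]
    simp only [d]
    rw [← cfc_mul ..]
    have : (spectrum ℝ (star a * a)).EqOn (fun x ↦ √(1 - x) * √(1 - x)) (fun x ↦ 1 - x) := by
      intro x hx
      have h1 : ‖x‖ ≤ ‖star a * a‖ * ‖(1 : A)‖ := spectrum.norm_le_norm_mul_of_mem hx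
      rcases subsingleton_or_nontrivial A with hA | hA
      · simp [Subsingleton.elim (1 : A) 0] at h1
        simp [h1]
      rw [CStarRing.norm_one, mul_one] at h1
      exact Real.mul_self_sqrt (by linarith [le_abs_self x, h1.trans hn, Real.norm_eq_abs x])
    rw [cfc_congr this, cfc_sub .., cfc_const_one .., cfc_id' ..]
  have h := (Complex.nonneg_iff.1 (hP (d * b))).1
  have : star (d * b) * (d * b) = star b * b - star (a * b) * (a * b) := by
    rw [star_mul, star_mul, mul_assoc, ← mul_assoc (star d), hd]
    noncomm_ring
  rw [this, map_sub, Complex.sub_re] at h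
  linarith

variable {B : Type*} [CStarAlgebra B]

/-- The estimate behind existence: for a contraction `a` commuting with the image of `B`, the number
`Re P (a c)` exceeds by at most `ε` the value of `Re P (x c)` at some contraction `x` of `B`. -/
theorem exists_re_map_mul_le (hP : ∀ a, 0 ≤ P (star a * a)) (hP1 : P 1 = 1)
    (i : B →⋆ₐ[ℂ] A) {a : A} (ha : ‖a‖ ≤ 1) (hai : ∀ b, Commute a (i b)) (c : B) [IsStarNormal c]
    {ε : ℝ} (hε : 0 < ε) :
    ∃ x : B, ‖x‖ ≤ 1 ∧ (P (a * i c)).re ≤ (P (i x * i c)).re + ε := by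
  have hpos : ∀ z : ℂ, 0 < ‖z‖ + ε := fun z ↦ by positivity
  let g : ℂ → ℂ := fun z ↦ (√(‖z‖ + ε) : ℝ)
  have hg : ∀ z, g z * g z = ‖z‖ + ε := fun z ↦ by
    simp only [g]
    rw [← Complex.ofReal_mul, Real.mul_self_sqrt (hpos z).le]
    push_cast; rfl
  have hg0 : ∀ z, g z ≠ 0 := fun z ↦ by
    simpa [g] using (Real.sqrt_pos.2 (hpos z)).ne'
  have hgstar : ∀ z, star (g z) = g z := fun z ↦ Complex.conj_ofReal _
  have hgc : Continuous g := Complex.continuous_ofReal.comp (by fun_prop)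
  have hfc : Continuous fun z : ℂ ↦ z / g z := continuous_id.div₀ hgc hg0
  have hkc : Continuous fun z : ℂ ↦ ε / g z := continuous_const.div₀ hgc hg0
  have hne : ∀ z : ℂ, (‖z‖ : ℂ) + ε ≠ 0 := fun z ↦ by
    exact_mod_cast (hpos z).ne'
  have hxc : Continuous fun z : ℂ ↦ star z / (‖z‖ + ε) := by fun_prop (disch := exact hne)
  -- `c = s t`, where `s* s` and `t* t` both approximate `|c|`, and `x` approximates the adjoint of
  -- the phase of `c`. The defect between them is controlled by `s* s + w* w = t* t + 2 ε`.
  let s : B := cfc g c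
  let t : B := cfc (fun z ↦ z / g z) c
  let w : B := cfc (fun z ↦ ε / g z) c
  let x : B := cfc (fun z : ℂ ↦ star z / (‖z‖ + ε)) c
  have hid : c = cfc (fun z : ℂ ↦ z) c := (cfc_id' ℂ c).symm
  have hxc' : x * c = cfc (fun z : ℂ ↦ star z / (‖z‖ + ε) * z) c := by
    rw [cfc_mul _ _ c hxc.continuousOn (by fun_prop), ← hid]
  have hst : star s * t = c := by
    rw [← cfc_star, ← cfc_mul _ _ c (hgc.star.continuousOn) hfc.continuousOn]
    conv_rhs => rw [hid]
    congr 1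
    ext1 z
    rw [hgstar, mul_div_cancel₀ _ (hg0 z)]
  have htt : star t * t = x * c := by
    rw [hxc', ← cfc_star, ← cfc_mul _ _ c (hfc.star.continuousOn) hfc.continuousOn]
    congr 1
    ext1 z
    rw [star_div₀, hgstar, div_mul_div_comm, hg, div_mul_eq_mul_div]
  have hss : star s * s + star w * w = x * c + algebraMap ℂ B (2 * ε) := by
    rw [hxc', ← cfc_star, ← cfc_star, ← cfc_mul _ _ c hgc.star.continuousOn hgc.continuousOn,
      ← cfc_mul _ _ c hkc.star.continuousOn hkc.continuousOn,
      ← cfc_add c (fun z ↦ star (g z) * g z) (fun z ↦ star (ε / g z) * (ε / g z))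
        (hgc.star.mul hgc).continuousOn (hkc.star.mul hkc).continuousOn,
      ← cfc_const _ c, ← cfc_add c (fun z : ℂ ↦ star z / (‖z‖ + ε) * z) _
        (hxc.mul continuous_id).continuousOn (by fun_prop)]
    congr 1
    ext1 z
    have hz : star z * z = (‖z‖ : ℂ) ^ 2 := by
      rw [mul_comm]; exact Complex.mul_conj' z
    have hε' : star (ε : ℂ) = ε := Complex.conj_ofReal _
    rw [star_div₀, hgstar, div_mul_div_comm, hg, hε', div_mul_eq_mul_div, hz]
    field_simp [hne z]
    ring
  refine ⟨x, norm_cfc_le zero_le_one fun z _ ↦ ?_, ?_⟩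
  · rw [norm_div, norm_star, ← Complex.ofReal_add, Complex.norm_real,
      Real.norm_of_nonneg (hpos z).le]
    exact div_le_one_of_le₀ (by linarith) (hpos z).le
  have h1 := two_mul_re_le hP (i s) (a * i t)
  have h2 := re_map_star_mul_le hP ha (i t)
  have h3 := (Complex.nonneg_iff.1 (hP (i w))).1
  have h4 := congr_arg (fun b ↦ (P (i b)).re) hss
  have h5 : star (i s) * (a * i t) = a * i c := by
    rw [← mul_assoc, ← map_star i s, ← (hai _).eq, mul_assoc, ← map_mul, hst]
  have h6 : star (i t) * i t = i x * i c := by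
    rw [← map_star i t, ← map_mul, htt, map_mul]
  rw [h5] at h1
  rw [h6] at h2
  simp [Algebra.algebraMap_eq_smul_one, hP1, map_star i] at h4
  linarith

end CStar

/-! ### Conditional expectation onto a central subalgebra -/

section CondExp

open Set

variable {H : Type*} [NormedAddCommGroup H] [InnerProductSpace ℂ H] [CompleteSpace H]

theorem isClosed_toStarSubalgebra (S : VonNeumannAlgebra H) :
    IsClosed (S.toStarSubalgebra : Set (H →L[ℂ] H)) := by
  rw [VonNeumannAlgebra.coe_toStarSubalgebra, ← S.centralizer_centralizer]
  exact Set.isClosed_centralizer _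

-- This makes von Neumann algebras C*-algebras. It stays local, because globally it would lead
-- instance search to another, merely definitionally equal, linear structure on them.
attribute [local instance] isClosed_toStarSubalgebra

variable {𝒜 𝒞 : VonNeumannAlgebra H} {P : 𝒜.toStarSubalgebra →ₗ[ℂ] ℂ}
  (h𝒞 : (𝒞 : Set (H →L[ℂ] H)) ⊆ center 𝒜)

/-- The inclusion `incl` of a subalgebra of the center, as a homomorphism of star algebras. -/
def inclHom : 𝒞.toStarSubalgebra →⋆ₐ[ℂ] 𝒜.toStarSubalgebra where
  toFun := incl h𝒞
  map_one' := rfl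
  map_mul' _ _ := rfl
  map_zero' := rfl
  map_add' _ _ := rfl
  commutes' _ := rfl
  map_star' _ := rfl

theorem commute_incl (A : 𝒜.toStarSubalgebra) (C : 𝒞.toStarSubalgebra) :
    Commute A (incl h𝒞 C) :=
  Subtype.ext ((h𝒞 C.2).2 A A.2)

theorem mul_comm_of_subset_center (h𝒞 : (𝒞 : Set (H →L[ℂ] H)) ⊆ center 𝒜)
    (X Y : 𝒞.toStarSubalgebra) : X * Y = Y * X :=
  Subtype.ext ((h𝒞 Y.2).2 X (h𝒞 X.2).1)

/-- For a normal functional `P` and fixed `C ∈ 𝒞`, the map `X ↦ P (X C)` is weak operator continuous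
on the unit ball of `𝒞`. -/
theorem continuous_map_mul_incl (hP : IsNormal 𝒜 P) (C : 𝒞.toStarSubalgebra) :
    Continuous fun T : {T : H →WOT[ℂ] H | T.toCLM ∈ 𝒞 ∧ ‖T.toCLM‖ ≤ 1} ↦
      P (incl h𝒞 ⟨T.1.toCLM, T.2.1⟩ * incl h𝒞 C) := by
  -- Normality only speaks of the unit ball, so `C` is first scaled into it.
  let c : ℝ := ‖C‖ + 1
  have hc : 0 < c := by positivity
  let D : 𝒞.toStarSubalgebra := ((c⁻¹ : ℝ) : ℂ) • C
  have hD : ‖(D : H →L[ℂ] H)‖ ≤ 1 := by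
    have : ‖((c⁻¹ : ℝ) : ℂ) • (C : H →L[ℂ] H)‖ ≤ 1 := by
      rw [norm_smul, Complex.norm_real, Real.norm_of_nonneg (by positivity),
        inv_mul_le_iff₀ hc, mul_one]
      exact (lt_add_one ‖C‖).le
    exact this
  have hCD : incl h𝒞 C = (c : ℂ) • incl h𝒞 D := by
    refine Subtype.ext ?_
    change (C : H →L[ℂ] H) = (c : ℂ) • ((c⁻¹ : ℝ) : ℂ) • (C : H →L[ℂ] H)
    rw [smul_smul, ← Complex.ofReal_mul, mul_inv_cancel₀ hc.ne', Complex.ofReal_one, one_smul]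
  simp_rw [hCD, mul_smul_comm, map_smul]
  refine Continuous.const_smul ?_ (c : ℂ)
  let _ : TopologicalSpace {A : 𝒜.toStarSubalgebra // ‖(A : H →L[ℂ] H)‖ ≤ 1} :=
    TopologicalSpace.induced
      (fun A ↦ (ContinuousLinearMapWOT.ofCLM (A.1 : H →L[ℂ] H) : H →WOT[ℂ] H)) inferInstance
  have hP' : Continuous fun A : {A : 𝒜.toStarSubalgebra // ‖(A : H →L[ℂ] H)‖ ≤ 1} ↦ P A.1 := hP
  have hmul : Continuous fun T : {T : H →WOT[ℂ] H | T.toCLM ∈ 𝒞 ∧ ‖T.toCLM‖ ≤ 1} ↦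
      (⟨incl h𝒞 ⟨T.1.toCLM, T.2.1⟩ * incl h𝒞 D,
        (norm_mul_le _ _).trans (mul_le_one₀ T.2.2 (norm_nonneg _) hD)⟩ :
        {A : 𝒜.toStarSubalgebra // ‖(A : H →L[ℂ] H)‖ ≤ 1}) := by
    refine continuous_induced_rng.2 ?_
    exact (continuous_mul_const (ContinuousLinearMapWOT.ofCLM (D : H →L[ℂ] H))).comp
      continuous_subtype_val
  exact hP'.comp hmul

theorem exists_isVersion_of_norm_le_one (hP : IsNormalState 𝒜 P) (A : 𝒜.toStarSubalgebra)
    (hA : ‖A‖ ≤ 1) : ∃ X, IsVersion P h𝒞 A X := by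
  let K : Set (H →WOT[ℂ] H) := {T | T.toCLM ∈ 𝒞 ∧ ‖T.toCLM‖ ≤ 1}
  have : CompactSpace K := isCompact_iff_compactSpace.1 (isCompact_wot_unitBall_inter 𝒞)
  let i := (inclHom h𝒞 : 𝒞.toStarSubalgebra →⋆ₐ[ℂ] 𝒜.toStarSubalgebra).toAlgHom.toLinearMap
  let Φ : 𝒞.toStarSubalgebra →ₗ[ℂ] Module.Dual ℂ 𝒞.toStarSubalgebra :=
    ((LinearMap.mul ℂ 𝒜.toStarSubalgebra).compr₂ P).compl₁₂ i i
  let ψ : Module.Dual ℂ 𝒞.toStarSubalgebra :=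
    ((LinearMap.mul ℂ 𝒜.toStarSubalgebra).compr₂ P A) ∘ₗ i
  let φ : K → Module.Dual ℂ 𝒞.toStarSubalgebra := fun T ↦ Φ ⟨T.1.toCLM, T.2.1⟩
  have hrange : range φ = Φ '' {X | ‖X‖ ≤ 1} := by
    refine subset_antisymm (range_subset_iff.2 fun T ↦ mem_image_of_mem Φ T.2.2) ?_
    exact image_subset_iff.2 fun X hX ↦
      mem_range_self (f := φ) ⟨ContinuousLinearMapWOT.ofCLM X.1, X.2, hX⟩
  have hconv : Convex ℝ (range φ) := by
    have hball : {X : 𝒞.toStarSubalgebra | ‖X‖ ≤ 1} = Metric.closedBall 0 1 :=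
      Set.ext fun X ↦ (mem_closedBall_zero_iff (a := X)).symm
    rw [hrange, hball]
    exact (convex_closedBall (0 : 𝒞.toStarSubalgebra) 1).linear_image (Φ.restrictScalars ℝ)
  obtain ⟨T, hT⟩ := exists_eq_of_forall_re_le φ (continuous_map_mul_incl h𝒞 hP.normal)
      hconv ψ <| by
    intro C u hu
    -- Every element of the commutative algebra `𝒞` is normal.
    have : IsStarNormal C := ⟨mul_comm_of_subset_center h𝒞 _ _⟩
    refine le_of_forall_pos_le_add fun ε hε ↦ ?_
    obtain ⟨X, hX, hXA⟩ := exists_re_map_mul_le hP.nonneg hP.map_one (inclHom h𝒞) hA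
      (commute_incl h𝒞 A) C hε
    exact hXA.trans <| add_le_add_left (hu ⟨.ofCLM X.1, X.2, hX⟩) ε
  exact ⟨_, fun C ↦ LinearMap.congr_fun hT C⟩

theorem exists_isVersion (hP : IsNormalState 𝒜 P) (A : 𝒜.toStarSubalgebra) :
    ∃ X, IsVersion P h𝒞 A X := by
  have hc : 0 < ‖A‖ + 1 := by positivity
  obtain ⟨X, hX⟩ := exists_isVersion_of_norm_le_one h𝒞 hP (((‖A‖ + 1)⁻¹ : ℝ) • A) <| by
    rw [norm_smul, Real.norm_of_nonneg (by positivity), inv_mul_le_iff₀ hc, mul_one]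
    exact (lt_add_one ‖A‖).le
  refine ⟨((‖A‖ + 1 : ℝ) : ℂ) • X, fun C ↦ ?_⟩
  have h := congr_arg (((‖A‖ + 1 : ℝ) : ℂ) • ·) (hX C)
  simp only [← map_smul, ← smul_mul_assoc] at h
  rw [← Complex.coe_smul, smul_smul, ← Complex.ofReal_mul, mul_inv_cancel₀ hc.ne',
    Complex.ofReal_one, one_smul] at h
  exact h

/-- If `X` is a version of `P(A|𝒞)`, then `A - X` is orthogonal to `𝒞`. -/
theorem IsVersion.map_sub_mul_incl {A : 𝒜.toStarSubalgebra} {X : 𝒞.toStarSubalgebra}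
    (hX : IsVersion P h𝒞 A X) (C : 𝒞.toStarSubalgebra) :
    P ((A - incl h𝒞 X) * incl h𝒞 C) = 0 := by
  rw [sub_mul, map_sub, hX C, sub_self]

theorem IsVersion.stateNorm_sub_eq_zero {A : 𝒜.toStarSubalgebra} {X Y : 𝒞.toStarSubalgebra}
    (hX : IsVersion P h𝒞 A X) (hY : IsVersion P h𝒞 A Y) :
    stateNorm P (incl h𝒞 X - incl h𝒞 Y) = 0 := by
  have h : P (star (incl h𝒞 (X - Y)) * incl h𝒞 (X - Y)) = 0 := by
    rw [(commute_incl h𝒞 _ _).eq]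
    have h1 := hX (star (X - Y))
    rw [← hY (star (X - Y)), ← sub_eq_zero, ← map_sub, ← sub_mul] at h1
    exact h1
  have h' : P (star (incl h𝒞 X - incl h𝒞 Y) * (incl h𝒞 X - incl h𝒞 Y)) = 0 := h
  rw [stateNorm, h', Complex.zero_re, Real.sqrt_zero]

/-- Least squares: with `D = A - X` and `E = X - C`, the cross terms in `P ((D + E)* (D + E))`
vanish. -/
theorem IsVersion.stateNorm_sub_le (hP : ∀ A, 0 ≤ P (star A * A)) {A : 𝒜.toStarSubalgebra}
    {X : 𝒞.toStarSubalgebra} (hX : IsVersion P h𝒞 A X) (C : 𝒞.toStarSubalgebra) :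
    stateNorm P (A - incl h𝒞 X) ≤ stateNorm P (A - incl h𝒞 C) := by
  let D := A - incl h𝒞 X
  let E := incl h𝒞 (X - C)
  have h1 : P (star E * D) = 0 := by
    have : star E * D = D * incl h𝒞 (star (X - C)) := (commute_incl h𝒞 D (star (X - C))).eq.symm
    rw [this]
    exact hX.map_sub_mul_incl h𝒞 _
  have h2 : P (star D * E) = 0 := by
    rw [← star_star E, ← star_mul, map_star_of_nonneg hP, h1, star_zero]
  have h3 : A - incl h𝒞 C = D + E := by
    change _ = A - incl h𝒞 X + (incl h𝒞 X - incl h𝒞 C)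
    abel
  refine Real.sqrt_le_sqrt ?_
  have h4 := (Complex.nonneg_iff.1 (hP E)).1
  have h5 : P (star (D + E) * (D + E)) = P (star D * D) + P (star E * E) := by
    simp only [star_add, add_mul, mul_add, map_add, h1, h2]
    ring
  rw [h3, h5, Complex.add_re]
  change (P (star D * D)).re ≤ _
  linarith

end CondExp

end QuantumProb

theorem mainTheorem11 {H : Type*} [NormedAddCommGroup H] [InnerProductSpace ℂ H]
    [CompleteSpace H] (𝒜 𝒞 : VonNeumannAlgebra H) (P : 𝒜.toStarSubalgebra →ₗ[ℂ] ℂ)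
    (hP : QuantumProb.IsNormalState 𝒜 P)
    (h𝒞 : (𝒞 : Set (H →L[ℂ] H)) ⊆ QuantumProb.center 𝒜) :
    (∃ E : 𝒜.toStarSubalgebra → 𝒞.toStarSubalgebra, QuantumProb.IsCondExp P h𝒞 E) ∧
    (∀ (A : 𝒜.toStarSubalgebra) (X Y : 𝒞.toStarSubalgebra),
      QuantumProb.IsVersion P h𝒞 A X → QuantumProb.IsVersion P h𝒞 A Y →
        QuantumProb.stateNorm P (QuantumProb.incl h𝒞 X - QuantumProb.incl h𝒞 Y) = 0) ∧
    (∀ (A : 𝒜.toStarSubalgebra) (X : 𝒞.toStarSubalgebra), QuantumProb.IsVersion P h𝒞 A X →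
      ∀ C : 𝒞.toStarSubalgebra,
        QuantumProb.stateNorm P (A - QuantumProb.incl h𝒞 X) ≤
          QuantumProb.stateNorm P (A - QuantumProb.incl h𝒞 C)) := by
  refine ⟨?_, fun A X Y hX hY ↦ hX.stateNorm_sub_eq_zero h𝒞 hY,
    fun A X hX C ↦ hX.stateNorm_sub_le h𝒞 hP.nonneg C⟩
  choose E hE using QuantumProb.exists_isVersion h𝒞 hP
  exact ⟨E, hE⟩
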